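/- **Setting ($K=2$ arms).** Let $\mathcal X\subset\mathbb R^d$ be non-empty. A policy is a map $\pi(a\mid x)\in[0,1]$, measurable in $x\in\mathcal X$, with $\pi(1\mid x)+\pi(2\mid x)=1$. A policy class $\Pi$ shatters a finite set $S\subset\mathcal X$ if for every $f:S\to\{1,2\}$ there is $\pi\in\Pi$ with $\pi(f(s)\mid s)=1$ for all $s\in S$; the VC dimension $d_{\mathrm{VC}}(\Pi)$ is the largest cardinality of a shattered set. Given $\sigma^1,\sigma^2:\mathcal X\to(0,\infty)$ and a probability distribution $\zeta$ on $\mathcal X$, the location-shift model $\mathcal P_\zeta$ consists of all laws $P$ of $(X,Y^1,Y^2)$ on $\mathcal X\times\mathbb R^2$ such that $X\sim\zeta$, the $Y^a$ are integrable and, for $\zeta$-almost every $x$ and each $a$, conditionally on $X=x$ the outcome $Y^a$ has variance $(\sigma^a(x))^2$ and $Y^a-\mu^a(P)(x)$ is sub-Gaussian, where $\mu^a(P)(x)=\mathbb E_P[Y^a\mid X=x]$. A strategy with policy class $\Pi$ does the following for each budget $T$. In rounds $t=1,\dots,T$ a tuple $(X_t,Y^1_t,Y^2_t)$ is drawn independently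 from $P$; an arm $A_t$ is chosen, possibly at random, from $(X_s,A_s,Y_s)_{s<t}$ and $X_t$; then $Y_t=Y_t^{A_t}$ is observed. After round $T$ a policy $\widehat\pi_T\in\Pi$ is chosen as a function of $(X_t,A_t,Y_t)_{t\le T}$, and for a context $x$ the arm $\widehat a_T(x)$ is drawn from $\widehat\pi_T(\cdot\mid x)$. With $Q(P)(\pi)=\mathbb E_{X\sim\zeta}\big[\sum_a\pi(a\mid X)\mu^a(P)(X)\big]$, its expected simple regret is $\mathbb E_P[R_T(P)(\widehat\pi_T)]$, where $R_T(P)(\widehat\pi_T)=\sup_{\pi\in\Pi}Q(P)(\pi)-Q(P)(\widehat\pi_T)$. The strategy is null consistent (over $\mathcal P_\zeta$) if for every $P\in\mathcal P_\zeta$ and $\zeta$-almost every $x$ with $\mu^1(P)(x)=\mu^2(P)(x)$, $$\big|\mathbb P_P(\widehat a_T(x)=1)-\mathbb P_P(\widehat a_T(x)=2)\big|\to0\qquad(T\to\infty).$$ **Theorem.** Let $M\in\{0,1,2,\dots\}$ and let $\Pi$ be a policy class with $d_{\mathrm{VC}}(\Pi)=M$. There is a probability distribution $\zeta$ on $\mathcal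 X$ such that for all $\sigma^1,\sigma^2:\mathcal X\to(0,\infty)$ the expectation on the right-hand side below is finite and every null consistent strategy with policy class $\Pi$ satisfies $$\sup_{P\in\mathcal P_\zeta}\sqrt T\,\mathbb E_P\big[R_T(P)(\widehat\pi_T)\big]\ \ge\ \frac18\,\mathbb E_{X\sim\zeta}\Big[\sqrt{M\big(\sigma^1(X)+\sigma^2(X)\big)^2}\Big]+o(1)\qquad\text{as }T\to\infty,$$ where the supremum takes values in $[0,\infty]$. -/

import Mathlib

open MeasureTheory ProbabilityTheory Filter Topology

namespace ContextualBAI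

noncomputable section

/-- A (stochastic) policy with `K` arms on the context space `𝕏`: `prob a x` is the probability
of recommending arm `a` in context `x`. -/
structure Policy (𝕏 : Type*) [MeasurableSpace 𝕏] (K : ℕ) where
  prob : Fin K → 𝕏 → ℝ
  measurable_prob : ∀ a, Measurable (prob a)
  prob_nonneg : ∀ a x, 0 ≤ prob a x
  sum_prob : ∀ x, ∑ a, prob a x = 1

section VC

variable {𝕏 : Type*} [MeasurableSpace 𝕏]

/-- A class of two-armed policies shatters the finite set `S` if every labelling of `S` by the two
arms is realised by some policy of the class (which recommends the label with probability one). -/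
def Shatters (C : Set (Policy 𝕏 2)) (S : Finset 𝕏) : Prop :=
  ∀ f : 𝕏 → Fin 2, ∃ p ∈ C, ∀ s ∈ S, p.prob (f s) s = 1

/-- The Vapnik-Chervonenkis dimension of a class of two-armed policies: the largest cardinality
of a shattered finite set (`⊤` if there is no largest one). -/
def vcDim (C : Set (Policy 𝕏 2)) : ℕ∞ :=
  ⨆ (S : Finset 𝕏) (_ : Shatters C S), (S.card : ℕ∞)

end VC

/-- What is observed in one round: the context, the assigned arm, and the outcome of that arm. -/
abbrev Obs (𝕏 : Type*) (K : ℕ) : Type _ := 𝕏 × Fin K × ℝ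

/-- A strategy with policy class `C`, for every budget `T`.
`sampling T t` is the conditional law of the arm assigned after `t` completed rounds, given the
observations of these rounds and the new context; only `t < T` matters. Arms that are a
measurable function of the past are the special case of a deterministic kernel.
`recommend T` chooses a policy in `C` from the observations of all `T` rounds; the recommended
arm for the context `x` is then drawn from that policy at `x`. -/
structure Strategy (𝕏 : Type*) [MeasurableSpace 𝕏] (K : ℕ) (C : Set (Policy 𝕏 K)) where
  sampling : ∀ _ t : ℕ, Kernel ((Fin t → Obs 𝕏 K) × 𝕏) (Fin K)
  markov_sampling : ∀ T t, IsMarkovKernel (sampling T t)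
  recommend : ∀ T : ℕ, (Fin T → Obs 𝕏 K) → Policy 𝕏 K
  recommend_mem : ∀ T h, recommend T h ∈ C
  measurable_recommend : ∀ T a x, Measurable fun h => (recommend T h).prob a x

section Model

variable {𝕏 : Type*} [MeasurableSpace 𝕏] {K : ℕ}

/-- The conditional mean of the outcome of arm `a` given the context `x`, where `P` is the law of
the context and the `K` potential outcomes. -/
def condMean (P : ProbabilityMeasure (𝕏 × (Fin K → ℝ))) (a : Fin K) (x : 𝕏) : ℝ :=
  ∫ y, y a ∂((P : Measure (𝕏 × (Fin K → ℝ))).condKernel x)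

/-- The location-shift bandit model with conditional standard deviations `σ` and context law `ζ`.
As usual, statements on conditional laws given `X = x` are meant for `ζ`-almost every `x`. The
outcomes are integrable, so that their conditional means and the values of policies exist. -/
def banditModel (σ : Fin K → 𝕏 → ℝ) (ζ : ProbabilityMeasure 𝕏) :
    Set (ProbabilityMeasure (𝕏 × (Fin K → ℝ))) :=
  {P | (P : Measure (𝕏 × (Fin K → ℝ))).fst = ζ ∧
    (∀ a, Integrable (fun z : 𝕏 × (Fin K → ℝ) => z.2 a) (P : Measure (𝕏 × (Fin K → ℝ)))) ∧
    ∀ a, ∀ᵐ x ∂(ζ : Measure 𝕏),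
      variance (fun y : Fin K → ℝ => y a) ((P : Measure (𝕏 × (Fin K → ℝ))).condKernel x)
        = σ a x ^ 2 ∧
      ∃ c, HasSubgaussianMGF (fun y : Fin K → ℝ => y a - condMean P a x) c
        ((P : Measure (𝕏 × (Fin K → ℝ))).condKernel x)}

/-- The value `E[∑ₐ π(a | X) μᵃ(X)]` of a policy. -/
def policyValue (P : ProbabilityMeasure (𝕏 × (Fin K → ℝ))) (p : Policy 𝕏 K) : ℝ :=
  ∫ x, ∑ a, p.prob a x * condMean P a x ∂(P : Measure (𝕏 × (Fin K → ℝ))).fst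

/-- The simple regret of the policy `p` relative to the best value within the class `C`. -/
def regret (P : ProbabilityMeasure (𝕏 × (Fin K → ℝ))) (C : Set (Policy 𝕏 K))
    (p : Policy 𝕏 K) : ℝ :=
  (⨆ q : C, policyValue P q) - policyValue P p

/-- The observation made when the context and potential outcomes are `q.1` and the arm is `q.2`. -/
def observe (q : (𝕏 × (Fin K → ℝ)) × Fin K) : Obs 𝕏 K := (q.1.1, q.2, q.1.2 q.2)

lemma measurable_observe : Measurable (observe : (𝕏 × (Fin K → ℝ)) × Fin K → Obs 𝕏 K) := by
  refine measurable_from_prod_countable_left fun a => ?_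
  exact measurable_fst.prodMk
    (measurable_const.prodMk ((measurable_pi_apply a).comp measurable_snd))

lemma measurable_snoc (t : ℕ) :
    Measurable fun p : (Fin t → Obs 𝕏 K) × Obs 𝕏 K =>
      (Fin.snoc p.1 p.2 : Fin (t + 1) → Obs 𝕏 K) := by
  refine measurable_pi_lambda _ fun i => ?_
  refine Fin.lastCases ?_ (fun j => ?_) i
  · simpa using measurable_snd
  · simp only [Fin.snoc_castSucc]
    exact (measurable_pi_apply j).comp measurable_fst

variable {C : Set (Policy 𝕏 K)}

namespace Strategy

instance (S : Strategy 𝕏 K C) (T t : ℕ) : IsMarkovKernel (S.sampling T t) :=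
  S.markov_sampling T t

/-- The law of the next observation given the first `t` ones: the context and the potential
outcomes are drawn from `P` independently of the past, the arm is drawn by the sampling rule given
the past and the context, and the outcome of that arm is observed. -/
def step (S : Strategy 𝕏 K C) (P : ProbabilityMeasure (𝕏 × (Fin K → ℝ))) (T t : ℕ) :
    Kernel (Fin t → Obs 𝕏 K) (Obs 𝕏 K) :=
  (Kernel.const (Fin t → Obs 𝕏 K) (P : Measure (𝕏 × (Fin K → ℝ))) ⊗ₖ
    (S.sampling T t).comap
      (fun q : (Fin t → Obs 𝕏 K) × (𝕏 × (Fin K → ℝ)) => (q.1, q.2.1)) (by fun_prop)).map observe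

instance (S : Strategy 𝕏 K C) (P : ProbabilityMeasure (𝕏 × (Fin K → ℝ))) (T t : ℕ) :
    IsMarkovKernel (S.step P T t) := by
  unfold step
  exact Kernel.IsMarkovKernel.map _ measurable_observe

/-- The law of the first `t` observations under `P`, for the strategy `S` with budget `T`. -/
def law (S : Strategy 𝕏 K C) (P : ProbabilityMeasure (𝕏 × (Fin K → ℝ))) (T : ℕ) :
    ∀ t : ℕ, Measure (Fin t → Obs 𝕏 K)
  | 0 => Measure.dirac Fin.elim0
  | t + 1 => ((law S P T t) ⊗ₘ (S.step P T t)).map fun p => Fin.snoc p.1 p.2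

instance (S : Strategy 𝕏 K C) (P : ProbabilityMeasure (𝕏 × (Fin K → ℝ))) (T t : ℕ) :
    IsProbabilityMeasure (S.law P T t) := by
  induction t with
  | zero => unfold law; infer_instance
  | succ t ih =>
    unfold law
    exact Measure.isProbabilityMeasure_map (measurable_snoc t).aemeasurable

/-- The probability under `P` that, after `T` rounds, arm `a` is recommended for the context `x`. -/
def recommendProb (S : Strategy 𝕏 K C) (P : ProbabilityMeasure (𝕏 × (Fin K → ℝ))) (T : ℕ)
    (a : Fin K) (x : 𝕏) : ℝ :=
  ∫ h, (S.recommend T h).prob a x ∂(S.law P T T)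

/-- The expected simple regret under `P` after `T` rounds; the simple regret is nonnegative. -/
def expectedRegret (S : Strategy 𝕏 K C) (P : ProbabilityMeasure (𝕏 × (Fin K → ℝ))) (T : ℕ) :
    ENNReal :=
  ∫⁻ h, ENNReal.ofReal (regret P C (S.recommend T h)) ∂(S.law P T T)

/-- Null consistency over the model with parameters `σ` and `ζ`: in contexts where all arms have
the same conditional mean, all arms are asymptotically recommended with equal probability. -/
def NullConsistent (S : Strategy 𝕏 K C) (σ : Fin K → 𝕏 → ℝ) (ζ : ProbabilityMeasure 𝕏) : Prop :=
  ∀ P ∈ banditModel σ ζ, ∀ᵐ x ∂(ζ : Measure 𝕏),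
    (∀ a b, condMean P a x = condMean P b x) →
      ∀ a b, Tendsto (fun T => |S.recommendProb P T a x - S.recommendProb P T b x|)
        atTop (𝓝 0)

end Strategy

end Model

end

end ContextualBAI

open ContextualBAI

/-! This is Assouad's method on a shattered set `A` of `M` contexts, with `ζ` uniform on `A`. Each
`B ⊆ A` gives a Gaussian instance: arm `a` has mean `± σ a x * θ`, and arm `0` is better on `B`, arm
`1` off `B`. Shattering puts the best labelling in the class, so the regret is at least the average
over `A` of `θ * (σ 0 x + σ 1 x)` times the probability of the worse arm (`le_regret_signShift`).

Both arms have signal-to-noise ratio `θ`, so no adaptive sampling rule gains information. The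
geometric mean of two likelihood ratios is a function of the context times the likelihood ratio of
the midpoint shift. Its expectation in one round therefore depends on neither the past nor the rule,
and powers of it control the whole experiment.

Moving one point `x` in or out of `B` leaves a one-round affinity of at least `1 - θ ^ 2 / (2 * M)`.
With `θ ^ 2 = M / (4 * T)` the affinity after `T` rounds is at least `7/8`, and the two error
probabilities at `x` sum to at least `1/2` (`Strategy.half_le_error_add_error`). Averaged over `B`,
the error at `x` is at least `1/4`. Since `√T * θ = √M / 2`, this gives the constant `1/8` for every
`T ≥ 1`. -/

namespace ContextualBAI

noncomputable section

/-! ### Integration against the law of an adaptive experiment -/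

section Law

variable {𝕏 : Type*} [MeasurableSpace 𝕏] {K : ℕ} {C : Set (Policy 𝕏 K)}

lemma Strategy.lintegral_step (S : Strategy 𝕏 K C) (P : ProbabilityMeasure (𝕏 × (Fin K → ℝ)))
    (T t : ℕ) (h : Fin t → Obs 𝕏 K) {F : Obs 𝕏 K → ENNReal} (hF : Measurable F) :
    ∫⁻ o, F o ∂(S.step P T t h) =
      ∫⁻ z, ∑ a, F (z.1, a, z.2 a) * S.sampling T t (h, z.1) {a}
        ∂(P : Measure (𝕏 × (Fin K → ℝ))) := by
  unfold step
  rw [Kernel.map_apply _ measurable_observe, lintegral_map hF measurable_observe,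
    Kernel.lintegral_compProd _ _ _ (f := fun q => F (observe q)) (hF.comp measurable_observe),
    Kernel.const_apply]
  refine lintegral_congr fun z => ?_
  rw [lintegral_fintype]
  rfl

lemma Strategy.lintegral_law_succ (S : Strategy 𝕏 K C)
    (P : ProbabilityMeasure (𝕏 × (Fin K → ℝ))) (T t : ℕ) {F : (Fin (t + 1) → Obs 𝕏 K) → ENNReal}
    (hF : Measurable F) :
    ∫⁻ h, F h ∂(S.law P T (t + 1)) =
      ∫⁻ h, ∫⁻ o, F (Fin.snoc h o) ∂(S.step P T t h) ∂(S.law P T t) := by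
  rw [law, lintegral_map hF (measurable_snoc t),
    Measure.lintegral_compProd (f := fun p => F (Fin.snoc p.1 p.2)) (hF.comp (measurable_snoc t))]

/-- A product of factors whose conditional expectations given the past are constant. -/
lemma Strategy.lintegral_law_prod (S : Strategy 𝕏 K C)
    (P : ProbabilityMeasure (𝕏 × (Fin K → ℝ))) (T : ℕ) {b : Obs 𝕏 K → ENNReal}
    (hb : Measurable b) (ρ : ENNReal) (h : ∀ t g, ∫⁻ o, b o ∂(S.step P T t g) = ρ) (t : ℕ) :
    ∫⁻ g, ∏ i, b (g i) ∂(S.law P T t) = ρ ^ t := by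
  induction t with
  | zero => simp
  | succ t ih =>
    rw [S.lintegral_law_succ P T t (by fun_prop)]
    simp only [Fin.prod_univ_castSucc, Fin.snoc_castSucc, Fin.snoc_last]
    simp_rw [lintegral_const_mul _ hb, h]
    rw [lintegral_mul_const _ (by fun_prop), ih, pow_succ]

/-- Change of measure for the whole experiment, from that for a single round. -/
lemma Strategy.lintegral_law_changeOfMeasure (S : Strategy 𝕏 K C)
    (P Q : ProbabilityMeasure (𝕏 × (Fin K → ℝ))) (T : ℕ) {l : Obs 𝕏 K → ENNReal}
    (hl : Measurable l)
    (h : ∀ t g, ∀ F : Obs 𝕏 K → ENNReal, Measurable F →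
      ∫⁻ o, F o ∂(S.step P T t g) = ∫⁻ o, F o * l o ∂(S.step Q T t g)) (t : ℕ) :
    ∀ F : (Fin t → Obs 𝕏 K) → ENNReal, Measurable F →
      ∫⁻ g, F g ∂(S.law P T t) = ∫⁻ g, F g * ∏ i, l (g i) ∂(S.law Q T t) := by
  induction t with
  | zero => intro F hF; simp [law]
  | succ t ih =>
    intro F hF
    have hs := measurable_snoc (𝕏 := 𝕏) (K := K) t
    rw [S.lintegral_law_succ P T t hF, S.lintegral_law_succ Q T t (by fun_prop),
      ih _ (Measurable.lintegral_kernel_prod_right' (f := fun p => F (Fin.snoc p.1 p.2))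
        (hF.comp hs))]
    refine lintegral_congr fun g => ?_
    have hFg : Measurable fun o => F (Fin.snoc g o) :=
      hF.comp (hs.comp measurable_prodMk_left)
    rw [h t g _ hFg, ← lintegral_mul_const _ (by fun_prop)]
    refine lintegral_congr fun o => ?_
    simp only [Fin.prod_univ_castSucc, Fin.snoc_castSucc, Fin.snoc_last]
    ring

end Law

/-! ### Gaussian shift models and their likelihood ratios -/

section GaussianShift

lemma lintegral_gaussianReal_shift (m : ℝ) {v : NNReal} (hv : v ≠ 0) {F : ℝ → ENNReal}
    (hF : Measurable F) :
    ∫⁻ y, F y ∂(gaussianReal m v) =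
      ∫⁻ y, F y * ENNReal.ofReal (Real.exp (m * y / v - m ^ 2 / (2 * v))) ∂(gaussianReal 0 v) := by
  rw [gaussianReal_of_var_ne_zero _ hv, gaussianReal_of_var_ne_zero _ hv,
    lintegral_withDensity_eq_lintegral_mul _ (measurable_gaussianPDF _ _) hF,
    lintegral_withDensity_eq_lintegral_mul _ (measurable_gaussianPDF _ _) (by fun_prop)]
  refine lintegral_congr fun y => ?_
  have hv' : (v : ℝ) ≠ 0 := by exact_mod_cast hv
  simp only [Pi.mul_apply, gaussianPDF]
  rw [mul_comm (F y), ← mul_assoc, ← ENNReal.ofReal_mul (gaussianPDFReal_nonneg _ _ _)]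
  congr 2
  simp only [gaussianPDFReal]
  rw [mul_assoc (√_)⁻¹ (Real.exp _), ← Real.exp_add]
  congr 2
  field_simp
  ring

/-- The sign of the mean shift of an arm. -/
def armSign (a : Fin 2) : ℝ := if a = 0 then 1 else -1

lemma armSign_zero : armSign 0 = 1 := by simp [armSign]

lemma armSign_one : armSign 1 = -1 := by simp [armSign]

lemma armSign_sq (a : Fin 2) : armSign a ^ 2 = 1 := by
  unfold armSign; split_ifs <;> norm_num

variable {𝕏 : Type*}

/-- Mean of arm `a`: the gap between the arms is `(σ 0 + σ 1) * η`, split in proportion to the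
standard deviations, so that both arms are equally informative. -/
def shiftMean (σ : Fin 2 → 𝕏 → ℝ) (η : 𝕏 → ℝ) (a : Fin 2) (x : 𝕏) : ℝ :=
  armSign a * σ a x * η x

/-- The Gaussian law of the outcome of arm `a` in context `x`. -/
def armLaw (σ : Fin 2 → 𝕏 → ℝ) (η : 𝕏 → ℝ) (a : Fin 2) (x : 𝕏) : Measure ℝ :=
  gaussianReal (shiftMean σ η a x) (Real.toNNReal (σ a x ^ 2))

instance (σ : Fin 2 → 𝕏 → ℝ) (η : 𝕏 → ℝ) (a : Fin 2) (x : 𝕏) :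
    IsProbabilityMeasure (armLaw σ η a x) := by
  unfold armLaw; infer_instance

/-- The law of both potential outcomes in context `x`. -/
def outcomeLaw (σ : Fin 2 → 𝕏 → ℝ) (η : 𝕏 → ℝ) (x : 𝕏) : Measure (Fin 2 → ℝ) :=
  Measure.pi fun a => armLaw σ η a x

instance (σ : Fin 2 → 𝕏 → ℝ) (η : 𝕏 → ℝ) (x : 𝕏) : IsProbabilityMeasure (outcomeLaw σ η x) := by
  unfold outcomeLaw; infer_instance

lemma outcomeLaw_map_eval (σ : Fin 2 → 𝕏 → ℝ) (η : 𝕏 → ℝ) (x : 𝕏) (a : Fin 2) :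
    (outcomeLaw σ η x).map (fun y => y a) = armLaw σ η a x :=
  (measurePreserving_eval (fun a => armLaw σ η a x) a).map_eq

/-- The likelihood ratio of one observation with respect to the model without shift. -/
def likelihood (σ : Fin 2 → 𝕏 → ℝ) (η : 𝕏 → ℝ) (o : Obs 𝕏 2) : ℝ :=
  Real.exp (η o.1 * (armSign o.2.1 * o.2.2 / σ o.2.1 o.1) - η o.1 ^ 2 / 2)

lemma likelihood_pos (σ : Fin 2 → 𝕏 → ℝ) (η : 𝕏 → ℝ) (o : Obs 𝕏 2) : 0 < likelihood σ η o :=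
  Real.exp_pos _

/-- With mean `m = ± σ η` and variance `v = σ ^ 2`, the exponent `m y / v - m ^ 2 / (2 v)` becomes
`± η y / σ - η ^ 2 / 2`: the quadratic term is the same for both arms. -/
lemma lintegral_armLaw_changeOfMeasure (σ : Fin 2 → 𝕏 → ℝ) (η : 𝕏 → ℝ) (a : Fin 2) (x : 𝕏)
    (hσ : 0 < σ a x) {F : ℝ → ENNReal} (hF : Measurable F) :
    ∫⁻ y, F y ∂(armLaw σ η a x) =
      ∫⁻ y, F y * ENNReal.ofReal (likelihood σ η (x, a, y)) ∂(armLaw σ 0 a x) := by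
  unfold armLaw
  rw [lintegral_gaussianReal_shift _ (by simpa using hσ.ne') hF]
  simp only [shiftMean, Pi.zero_apply, mul_zero]
  refine lintegral_congr fun y => ?_
  congr 3
  rw [Real.coe_toNNReal _ (sq_nonneg _), mul_pow, mul_pow, armSign_sq]
  dsimp only
  field_simp

variable [MeasurableSpace 𝕏]

lemma measurable_likelihood {σ : Fin 2 → 𝕏 → ℝ} {η : 𝕏 → ℝ} (hσ : ∀ a, Measurable (σ a))
    (hη : Measurable η) : Measurable (likelihood σ η) := by
  have h1 : Measurable fun o : Obs 𝕏 2 => σ o.2.1 o.1 :=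
    (measurable_from_prod_countable_left (f := fun p : 𝕏 × Fin 2 => σ p.2 p.1) hσ).comp
      (measurable_fst.prodMk (measurable_fst.comp measurable_snd))
  have h2 : Measurable fun o : Obs 𝕏 2 => armSign o.2.1 :=
    (Measurable.of_discrete (f := armSign)).comp (measurable_fst.comp measurable_snd)
  have h3 : Measurable fun o : Obs 𝕏 2 => η o.1 := hη.comp measurable_fst
  exact ((h3.mul ((h2.mul measurable_snd.snd).div h1)).sub ((h3.pow_const 2).div_const 2)).exp

/-- The uniform distribution on a finite set of contexts. -/
def uniformContext (A : Finset 𝕏) : Measure 𝕏 :=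
  ∑ x ∈ A, (A.card : ENNReal)⁻¹ • Measure.dirac x

lemma isProbabilityMeasure_uniformContext {A : Finset 𝕏} (hA : A.Nonempty) :
    IsProbabilityMeasure (uniformContext A) := by
  constructor
  have : (A.card : ENNReal) ≠ 0 := by simpa using hA.ne_empty
  simp [uniformContext, ENNReal.mul_inv_cancel this]

/-- Uniform contexts and shifted Gaussian outcomes. -/
def shiftModel (A : Finset 𝕏) (σ : Fin 2 → 𝕏 → ℝ) (η : 𝕏 → ℝ) : Measure (𝕏 × (Fin 2 → ℝ)) :=
  ∑ x ∈ A, (A.card : ENNReal)⁻¹ • (Measure.dirac x).prod (outcomeLaw σ η x)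

lemma fst_shiftModel (A : Finset 𝕏) (σ : Fin 2 → 𝕏 → ℝ) (η : 𝕏 → ℝ) :
    (shiftModel A σ η).fst = uniformContext A := by
  ext s hs
  simp only [Measure.fst_apply hs, shiftModel, uniformContext, Measure.finsetSum_apply,
    Measure.smul_apply]
  refine Finset.sum_congr rfl fun x _ => ?_
  rw [← Measure.fst_apply hs, Measure.fst_prod]

lemma isProbabilityMeasure_shiftModel {A : Finset 𝕏} (hA : A.Nonempty) (σ : Fin 2 → 𝕏 → ℝ)
    (η : 𝕏 → ℝ) : IsProbabilityMeasure (shiftModel A σ η) := by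
  have := isProbabilityMeasure_uniformContext hA
  constructor
  rw [← Measure.fst_univ, fst_shiftModel, measure_univ]

lemma lintegral_shiftModel (A : Finset 𝕏) (σ : Fin 2 → 𝕏 → ℝ) (η : 𝕏 → ℝ)
    {F : 𝕏 × (Fin 2 → ℝ) → ENNReal} (hF : Measurable F) :
    ∫⁻ z, F z ∂(shiftModel A σ η) =
      ∑ x ∈ A, (A.card : ENNReal)⁻¹ * ∫⁻ y, F (x, y) ∂(outcomeLaw σ η x) := by
  rw [shiftModel, lintegral_finsetSum_measure]
  refine Finset.sum_congr rfl fun x _ => ?_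
  rw [lintegral_smul_measure, lintegral_prod _ hF.aemeasurable,
    lintegral_dirac' _ hF.lintegral_prod_right', smul_eq_mul]

/-- `shiftModel` as a probability measure. -/
def shiftProb {A : Finset 𝕏} (hA : A.Nonempty) (σ : Fin 2 → 𝕏 → ℝ) (η : 𝕏 → ℝ) :
    ProbabilityMeasure (𝕏 × (Fin 2 → ℝ)) :=
  ⟨shiftModel A σ η, isProbabilityMeasure_shiftModel hA σ η⟩

variable {C : Set (Policy 𝕏 2)}

lemma Strategy.lintegral_step_shift (S : Strategy 𝕏 2 C) {A : Finset 𝕏} (hA : A.Nonempty)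
    (σ : Fin 2 → 𝕏 → ℝ) (η : 𝕏 → ℝ) (T t : ℕ) (h : Fin t → Obs 𝕏 2) {F : Obs 𝕏 2 → ENNReal}
    (hF : Measurable F) :
    ∫⁻ o, F o ∂(S.step (shiftProb hA σ η) T t h) =
      ∑ x ∈ A, (A.card : ENNReal)⁻¹ *
        ∑ a, (∫⁻ y, F (x, a, y) ∂(armLaw σ η a x)) * S.sampling T t (h, x) {a} := by
  have hk (a : Fin 2) : Measurable fun x => S.sampling T t (h, x) {a} :=
    (Kernel.measurable_coe _ (measurableSet_singleton a)).comp measurable_prodMk_left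
  have hF' (a : Fin 2) : Measurable fun z : 𝕏 × (Fin 2 → ℝ) => F (z.1, a, z.2 a) := by fun_prop
  have hm : Measurable fun z : 𝕏 × (Fin 2 → ℝ) =>
      ∑ a, F (z.1, a, z.2 a) * S.sampling T t (h, z.1) {a} :=
    Finset.measurable_fun_sum _ fun a _ => (hF' a).mul ((hk a).comp measurable_fst)
  rw [S.lintegral_step _ T t h hF, shiftProb, ProbabilityMeasure.coe_mk,
    lintegral_shiftModel _ _ _ hm]
  refine Finset.sum_congr rfl fun x _ => ?_
  congr 1
  have hx (a : Fin 2) : Measurable fun y : Fin 2 → ℝ => F (x, a, y a) :=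
    (hF' a).comp measurable_prodMk_left
  dsimp only
  rw [lintegral_finsetSum _ fun a _ => (hx a).mul_const _]
  refine Finset.sum_congr rfl fun a _ => ?_
  rw [lintegral_mul_const _ (hx a), ← outcomeLaw_map_eval,
    lintegral_map (by fun_prop) (by fun_prop)]

/-- The arm probabilities sum to one and the outcome integrates out, so the strategy, the past and
the shift all disappear. -/
lemma Strategy.lintegral_step_shift_context (S : Strategy 𝕏 2 C) {A : Finset 𝕏}
    (hA : A.Nonempty) (σ : Fin 2 → 𝕏 → ℝ) (η : 𝕏 → ℝ) (T t : ℕ) (h : Fin t → Obs 𝕏 2)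
    {g : 𝕏 → ENNReal} (hg : Measurable g) :
    ∫⁻ o, g o.1 ∂(S.step (shiftProb hA σ η) T t h) =
      ∑ x ∈ A, (A.card : ENNReal)⁻¹ * g x := by
  rw [S.lintegral_step_shift hA σ η T t h (by fun_prop)]
  refine Finset.sum_congr rfl fun x _ => ?_
  have h1 : ∑ a, S.sampling T t (h, x) {a} = 1 := by
    rw [sum_measure_singleton, Finset.coe_univ, measure_univ]
  simp [← Finset.mul_sum, h1]

/-- Contexts and sampling probabilities are common to the two models, so only the outcome density
contributes to the ratio. -/
lemma Strategy.lintegral_step_changeOfMeasure (S : Strategy 𝕏 2 C) {A : Finset 𝕏}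
    (hA : A.Nonempty) {σ : Fin 2 → 𝕏 → ℝ} (hσ : ∀ a x, 0 < σ a x) (hσm : ∀ a, Measurable (σ a))
    {η : 𝕏 → ℝ} (hη : Measurable η) (T t : ℕ) (h : Fin t → Obs 𝕏 2) (F : Obs 𝕏 2 → ENNReal)
    (hF : Measurable F) :
    ∫⁻ o, F o ∂(S.step (shiftProb hA σ η) T t h) =
      ∫⁻ o, F o * ENNReal.ofReal (likelihood σ η o) ∂(S.step (shiftProb hA σ 0) T t h) := by
  have hl := measurable_likelihood hσm hη
  rw [S.lintegral_step_shift hA σ η T t h hF, S.lintegral_step_shift hA σ 0 T t h (by fun_prop)]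
  refine Finset.sum_congr rfl fun x _ => ?_
  congr 1
  refine Finset.sum_congr rfl fun a _ => ?_
  rw [lintegral_armLaw_changeOfMeasure σ η a x (hσ a x) (by fun_prop)]

end GaussianShift

lemma Policy.prob_le_one {𝕏 : Type*} [MeasurableSpace 𝕏] {K : ℕ} (p : Policy 𝕏 K) (a : Fin K)
    (x : 𝕏) : p.prob a x ≤ 1 := by
  rw [← p.sum_prob x]
  exact Finset.single_le_sum (fun a _ => p.prob_nonneg a x) (Finset.mem_univ a)

/-! ### Moments of the outcomes in a fixed context -/

section OutcomeLaw

variable {𝕏 : Type*}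

lemma integral_outcomeLaw (σ : Fin 2 → 𝕏 → ℝ) (η : 𝕏 → ℝ) (x : 𝕏) (a : Fin 2) :
    ∫ y, y a ∂(outcomeLaw σ η x) = shiftMean σ η a x := by
  have h := integral_map (μ := outcomeLaw σ η x) (φ := fun y => y a) (f := fun y : ℝ => y)
    (measurable_pi_apply a).aemeasurable (by fun_prop)
  rw [← h, outcomeLaw_map_eval, armLaw, integral_id_gaussianReal]

lemma integrable_outcomeLaw (σ : Fin 2 → 𝕏 → ℝ) (η : 𝕏 → ℝ) (x : 𝕏) (a : Fin 2) :
    Integrable (fun y => y a) (outcomeLaw σ η x) := by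
  have h : Integrable id ((outcomeLaw σ η x).map fun y => y a) := by
    rw [outcomeLaw_map_eval, armLaw]
    exact (memLp_id_gaussianReal 1).integrable (by simp)
  exact (integrable_map_measure (g := id) (by fun_prop) (measurable_pi_apply a).aemeasurable).1 h

lemma variance_outcomeLaw (σ : Fin 2 → 𝕏 → ℝ) (η : 𝕏 → ℝ) (x : 𝕏) (a : Fin 2) :
    variance (fun y => y a) (outcomeLaw σ η x) = σ a x ^ 2 := by
  rw [← variance_id_map (measurable_pi_apply a).aemeasurable, outcomeLaw_map_eval, armLaw, variance_id_gaussianReal,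
    Real.coe_toNNReal _ (sq_nonneg _)]

lemma hasSubgaussianMGF_outcomeLaw (σ : Fin 2 → 𝕏 → ℝ) (η : 𝕏 → ℝ) (x : 𝕏) (a : Fin 2) :
    HasSubgaussianMGF (fun y => y a - shiftMean σ η a x) (Real.toNNReal (σ a x ^ 2))
      (outcomeLaw σ η x) := by
  have hmap : (outcomeLaw σ η x).map (fun y => y a - shiftMean σ η a x) =
      gaussianReal 0 (Real.toNNReal (σ a x ^ 2)) := by
    rw [← Function.comp_def (fun z : ℝ => z - shiftMean σ η a x) (fun y : Fin 2 → ℝ => y a),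
      ← Measure.map_map (by fun_prop) (by fun_prop), outcomeLaw_map_eval, armLaw,
      gaussianReal_map_sub_const, sub_self]
  refine ⟨fun t => ?_, fun t => ?_⟩
  · have h := integrable_exp_mul_gaussianReal (μ := 0) (v := Real.toNNReal (σ a x ^ 2)) t
    rw [← hmap] at h
    exact (integrable_map_measure (f := fun y : Fin 2 → ℝ => y a - shiftMean σ η a x)
      (g := fun z => Real.exp (t * z)) (by fun_prop)
      ((measurable_pi_apply a).sub_const _).aemeasurable).1 h
  · rw [mgf_gaussianReal hmap]
    simp

end OutcomeLaw

/-! ### Membership in the bandit model, and regret on a shattered set -/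

section Model

variable {𝕏 : Type*} [MeasurableSpace 𝕏] [MeasurableSingletonClass 𝕏]

lemma uniformContext_singleton {A : Finset 𝕏} {x : 𝕏} (hx : x ∈ A) :
    uniformContext A {x} = (A.card : ENNReal)⁻¹ := by
  classical
  simp only [uniformContext, Measure.finsetSum_apply, Measure.smul_apply, smul_eq_mul,
    Measure.dirac_apply' _ (measurableSet_singleton x), Set.indicator_apply,
    Set.mem_singleton_iff, Pi.one_apply, mul_ite, mul_one, mul_zero, Finset.sum_ite_eq', hx,
    if_true]

lemma ae_uniformContext {A : Finset 𝕏} {p : 𝕏 → Prop} (h : ∀ x ∈ A, p x) :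
    ∀ᵐ x ∂(uniformContext A), p x := by
  have hA : MeasurableSet (A : Set 𝕏) := A.measurableSet
  have : ∀ᵐ x ∂(uniformContext A), x ∈ (A : Set 𝕏) := by
    rw [ae_iff]
    simp only [uniformContext, Measure.finsetSum_apply, Measure.smul_apply, smul_eq_mul]
    refine Finset.sum_eq_zero fun x hx => ?_
    have hx' : {y | y ∉ (A : Set 𝕏)} = (A : Set 𝕏)ᶜ := rfl
    rw [hx', Measure.dirac_apply' _ hA.compl]
    simp [hx]
  filter_upwards [this] with x hx using h x hx

lemma integrable_uniformContext (A : Finset 𝕏) (f : 𝕏 → ℝ) :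
    Integrable f (uniformContext A) := by
  refine integrable_finsetSum_measure.2 fun x hx => ?_
  have : (A.card : ENNReal) ≠ 0 := by
    simpa using Finset.ne_empty_of_mem hx
  exact (integrable_dirac (by simp)).smul_measure (by simpa using this)

lemma integral_uniformContext (A : Finset 𝕏) (f : 𝕏 → ℝ) :
    ∫ x, f x ∂(uniformContext A) = ∑ x ∈ A, (A.card : ℝ)⁻¹ * f x := by
  have h := integrable_finsetSum_measure.1 (integrable_uniformContext A f)
  rw [uniformContext, integral_finsetSum_measure h]
  simp [integral_smul_measure]

/-- Points of `A` are atoms of the context law, so the conditional kernel is determined there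
exactly, by elementary conditioning. -/
lemma condKernel_shiftModel {A : Finset 𝕏} (hA : A.Nonempty) (σ : Fin 2 → 𝕏 → ℝ) (η : 𝕏 → ℝ)
    {x : 𝕏} (hx : x ∈ A) :
    (shiftProb hA σ η : Measure (𝕏 × (Fin 2 → ℝ))).condKernel x = outcomeLaw σ η x := by
  have hc : (A.card : ENNReal) ≠ 0 := by simpa using hA.ne_empty
  have h0 : (shiftProb hA σ η : Measure (𝕏 × (Fin 2 → ℝ))).fst {x} = (A.card : ENNReal)⁻¹ := by
    rw [shiftProb, ProbabilityMeasure.coe_mk, fst_shiftModel, uniformContext_singleton hx]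
  ext s hs
  rw [Measure.condKernel_apply_of_ne_zero (by rw [h0]; simp), h0, inv_inv, shiftProb,
    ProbabilityMeasure.coe_mk, shiftModel, Measure.finsetSum_apply, Finset.sum_eq_single x]
  · rw [Measure.smul_apply, Measure.prod_prod, smul_eq_mul, ← mul_assoc,
      ENNReal.mul_inv_cancel hc (by simp)]
    simp
  · intro y _ hy
    rw [Measure.smul_apply, Measure.prod_prod,
      Measure.dirac_apply' _ (measurableSet_singleton x)]
    simp [hy]
  · exact fun h => absurd hx h

lemma condMean_shiftModel {A : Finset 𝕏} (hA : A.Nonempty) (σ : Fin 2 → 𝕏 → ℝ) (η : 𝕏 → ℝ)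
    {x : 𝕏} (hx : x ∈ A) (a : Fin 2) :
    condMean (shiftProb hA σ η) a x = shiftMean σ η a x := by
  rw [condMean, condKernel_shiftModel hA σ η hx, integral_outcomeLaw]

/-- The model constrains only the contexts in `A`; this leaves room to replace `σ` by a measurable
`τ` that agrees with it there. -/
lemma shiftProb_mem_banditModel {A : Finset 𝕏} (hA : A.Nonempty) {σ τ : Fin 2 → 𝕏 → ℝ}
    (hτ : ∀ a, ∀ x ∈ A, τ a x = σ a x) (η : 𝕏 → ℝ) {ζ : ProbabilityMeasure 𝕏}
    (hζ : (ζ : Measure 𝕏) = uniformContext A) : shiftProb hA τ η ∈ banditModel σ ζ := by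
  refine ⟨?_, fun a => ?_, fun a => ?_⟩
  · rw [hζ, shiftProb, ProbabilityMeasure.coe_mk, fst_shiftModel]
  · rw [shiftProb, ProbabilityMeasure.coe_mk, shiftModel]
    refine integrable_finsetSum_measure.2 fun x hx => ?_
    have : (A.card : ENNReal) ≠ 0 := by simpa using hA.ne_empty
    exact ((integrable_outcomeLaw τ η x a).comp_snd _).smul_measure (by simpa using this)
  · rw [hζ]
    refine ae_uniformContext fun x hx => ?_
    rw [condKernel_shiftModel hA τ η hx, variance_outcomeLaw, hτ a x hx,
      condMean_shiftModel hA τ η hx]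
    exact ⟨rfl, _, hasSubgaussianMGF_outcomeLaw τ η x a⟩

lemma policyValue_shiftProb {A : Finset 𝕏} (hA : A.Nonempty) (σ : Fin 2 → 𝕏 → ℝ) (η : 𝕏 → ℝ)
    (p : Policy 𝕏 2) :
    policyValue (shiftProb hA σ η) p =
      ∑ x ∈ A, (A.card : ℝ)⁻¹ * ∑ a, p.prob a x * shiftMean σ η a x := by
  rw [policyValue, shiftProb, ProbabilityMeasure.coe_mk, fst_shiftModel, integral_uniformContext]
  refine Finset.sum_congr rfl fun x hx => ?_
  have h := condMean_shiftModel hA σ η hx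
  rw [shiftProb] at h
  simp only [h]

/-- Needed because a real `⨆` takes the default value `0` on an unbounded family. -/
lemma bddAbove_policyValue_shiftProb {A : Finset 𝕏} (hA : A.Nonempty) (σ : Fin 2 → 𝕏 → ℝ)
    (η : 𝕏 → ℝ) (C : Set (Policy 𝕏 2)) :
    BddAbove (Set.range fun q : C => policyValue (shiftProb hA σ η) q) := by
  refine ⟨∑ x ∈ A, (A.card : ℝ)⁻¹ * ∑ a, |shiftMean σ η a x|, ?_⟩
  rintro _ ⟨q, rfl⟩
  dsimp only
  rw [policyValue_shiftProb]
  gcongr with x _ a _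
  calc q.1.prob a x * shiftMean σ η a x ≤ q.1.prob a x * |shiftMean σ η a x| :=
        mul_le_mul_of_nonneg_left (le_abs_self _) (q.1.prob_nonneg a x)
    _ ≤ 1 * |shiftMean σ η a x| :=
        mul_le_mul_of_nonneg_right (q.1.prob_le_one a x) (abs_nonneg _)
    _ = _ := one_mul _

open Classical in
/-- The shift of size `θ` in favour of arm `0` on `B` and of arm `1` elsewhere. -/
def signShift (θ : ℝ) (B : Finset 𝕏) (x : 𝕏) : ℝ := if x ∈ B then θ else -θ

open Classical in
/-- The inferior arm under `signShift θ B`. -/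
def worseArm (B : Finset 𝕏) (x : 𝕏) : Fin 2 := if x ∈ B then 1 else 0

lemma measurable_signShift (θ : ℝ) (B : Finset 𝕏) : Measurable (signShift θ B) :=
  Measurable.ite B.measurableSet measurable_const measurable_const

/-- On a shattered set the regret is at least the mean loss from the inferior arms. -/
lemma le_regret_signShift {A : Finset 𝕏} (hA : A.Nonempty) (σ : Fin 2 → 𝕏 → ℝ) (θ : ℝ)
    (B : Finset 𝕏) {C : Set (Policy 𝕏 2)} (hC : Shatters C A) (p : Policy 𝕏 2) :
    ∑ x ∈ A, (A.card : ℝ)⁻¹ * (θ * (σ 0 x + σ 1 x)) * p.prob (worseArm B x) x ≤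
      regret (shiftProb hA σ (signShift θ B)) C p := by
  classical
  -- This labelling picks the better arm at every point of `A`; its value is a lower bound for the
  -- supremum.
  obtain ⟨q, hq, hqA⟩ := hC fun x => if x ∈ B then 0 else 1
  have h := le_ciSup (bddAbove_policyValue_shiftProb hA σ (signShift θ B) C) ⟨q, hq⟩
  refine le_trans (le_of_eq ?_) (sub_le_sub_right h _)
  dsimp only
  rw [policyValue_shiftProb, policyValue_shiftProb, ← Finset.sum_sub_distrib]
  refine Finset.sum_congr rfl fun x hx => ?_
  have h1 := p.sum_prob x
  have h2 := q.sum_prob x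
  have h3 := hqA x hx
  rw [Fin.sum_univ_two] at h1 h2
  rw [← mul_sub, mul_assoc]
  congr 1
  by_cases hB : x ∈ B
  · rw [if_pos hB] at h3
    have h4 : q.prob 1 x = 0 := by linarith
    simp only [Fin.sum_univ_two, shiftMean, armSign_zero, armSign_one, signShift, worseArm,
      if_pos hB, h3, h4, show p.prob 0 x = 1 - p.prob 1 x by linarith]
    ring
  · rw [if_neg hB] at h3
    have h4 : q.prob 0 x = 0 := by linarith
    simp only [Fin.sum_univ_two, shiftMean, armSign_zero, armSign_one, signShift, worseArm,
      if_neg hB, h3, h4, show p.prob 1 x = 1 - p.prob 0 x by linarith]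
    ring

end Model

/-! ### Testing between two shifts through their affinity -/

section Testing

variable {𝕏 : Type*}

/-- The geometric mean of the likelihood ratios of two shifts. -/
def affinity (σ : Fin 2 → 𝕏 → ℝ) (η η' : 𝕏 → ℝ) (o : Obs 𝕏 2) : ℝ :=
  Real.exp (-(η o.1 - η' o.1) ^ 2 / 8) * likelihood σ (fun x => (η x + η' x) / 2) o

lemma affinity_pos (σ : Fin 2 → 𝕏 → ℝ) (η η' : 𝕏 → ℝ) (o : Obs 𝕏 2) : 0 < affinity σ η η' o :=
  mul_pos (Real.exp_pos _) (likelihood_pos _ _ _)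

lemma affinity_sq (σ : Fin 2 → 𝕏 → ℝ) (η η' : 𝕏 → ℝ) (o : Obs 𝕏 2) :
    affinity σ η η' o ^ 2 = likelihood σ η o * likelihood σ η' o := by
  unfold affinity likelihood
  rw [← Real.exp_add, ← Real.exp_add, ← Real.exp_nat_mul]
  congr 1
  push_cast
  ring

/-- The testing inequality pointwise, a form of `4 √(l l') ≤ 4 min l l' + max l l'`. -/
lemma four_mul_le_of_sq_eq {l l' b p q : ℝ} (hl : 0 ≤ l) (hl' : 0 ≤ l') (hb : b ^ 2 = l * l')
    (hp : 0 ≤ p) (hq : 0 ≤ q) (hpq : p + q = 1) :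
    4 * b ≤ 3 * (p * l + q * l') + (l + l') := by
  obtain h | h := le_total l l'
  · have h1 : l ≤ p * l + q * l' := by
      have : q * l ≤ q * l' := mul_le_mul_of_nonneg_left h hq
      calc l = p * l + q * l := by rw [← add_mul, hpq, one_mul]
        _ ≤ _ := by linarith
    -- AM-GM for `4 * l` and `l'`; then `4 * l + l' = 3 * l + (l + l')`, with `l` the minimum.
    have h2 : 4 * b ≤ 4 * l + l' :=
      abs_le_of_sq_le_sq' (by nlinarith [sq_nonneg (4 * l - l')]) (by linarith) |>.2
    linarith
  · have h1 : l' ≤ p * l + q * l' := by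
      have : p * l' ≤ p * l := mul_le_mul_of_nonneg_left h hp
      calc l' = p * l' + q * l' := by rw [← add_mul, hpq, one_mul]
        _ ≤ _ := by linarith
    have h2 : 4 * b ≤ l + 4 * l' :=
      abs_le_of_sq_le_sq' (by nlinarith [sq_nonneg (4 * l' - l)]) (by linarith) |>.2
    linarith

variable [MeasurableSpace 𝕏] {C : Set (Policy 𝕏 2)}

lemma measurable_affinity {σ : Fin 2 → 𝕏 → ℝ} {η η' : 𝕏 → ℝ} (hσ : ∀ a, Measurable (σ a))
    (hη : Measurable η) (hη' : Measurable η') : Measurable (affinity σ η η') := by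
  have h1 : Measurable fun o : Obs 𝕏 2 => η o.1 := hη.comp measurable_fst
  have h2 : Measurable fun o : Obs 𝕏 2 => η' o.1 := hη'.comp measurable_fst
  exact ((((h1.sub h2).pow_const 2).neg).div_const 8).exp.mul
    (measurable_likelihood hσ ((hη.add hη').div_const 2))

/-- The midpoint likelihood ratio is absorbed by a change of measure; what remains depends on the
context alone. -/
lemma Strategy.lintegral_step_affinity (S : Strategy 𝕏 2 C) {A : Finset 𝕏} (hA : A.Nonempty)
    {σ : Fin 2 → 𝕏 → ℝ} (hσ : ∀ a x, 0 < σ a x) (hσm : ∀ a, Measurable (σ a)) {η η' : 𝕏 → ℝ}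
    (hη : Measurable η) (hη' : Measurable η') (T t : ℕ) (h : Fin t → Obs 𝕏 2) :
    ∫⁻ o, ENNReal.ofReal (affinity σ η η' o) ∂(S.step (shiftProb hA σ 0) T t h) =
      ENNReal.ofReal (∑ x ∈ A, (A.card : ℝ)⁻¹ * Real.exp (-(η x - η' x) ^ 2 / 8)) := by
  have hg : Measurable fun x => ENNReal.ofReal (Real.exp (-(η x - η' x) ^ 2 / 8)) := by fun_prop
  have hc : (0 : ℝ) < A.card := by exact_mod_cast hA.card_pos
  calc _ = ∫⁻ o, ENNReal.ofReal (Real.exp (-(η o.1 - η' o.1) ^ 2 / 8)) *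
        ENNReal.ofReal (likelihood σ (fun x => (η x + η' x) / 2) o)
          ∂(S.step (shiftProb hA σ 0) T t h) := by
        refine lintegral_congr fun o => ?_
        rw [affinity, ENNReal.ofReal_mul (Real.exp_pos _).le]
    _ = ∫⁻ o, ENNReal.ofReal (Real.exp (-(η o.1 - η' o.1) ^ 2 / 8))
          ∂(S.step (shiftProb hA σ fun x => (η x + η' x) / 2) T t h) :=
        (S.lintegral_step_changeOfMeasure hA hσ hσm ((hη.add hη').div_const 2) T t h _
          (hg.comp measurable_fst)).symm
    _ = _ := by
        rw [S.lintegral_step_shift_context hA σ _ T t h hg,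
          ENNReal.ofReal_sum_of_nonneg fun x _ => by positivity]
        refine Finset.sum_congr rfl fun x _ => ?_
        rw [ENNReal.ofReal_mul (by positivity), ENNReal.ofReal_inv_of_pos hc,
          ENNReal.ofReal_natCast]

/-- Testing between two shifts: the affinity bounds the sum of the error probabilities. -/
lemma Strategy.four_mul_affinity_pow_le (S : Strategy 𝕏 2 C) {A : Finset 𝕏} (hA : A.Nonempty)
    {σ : Fin 2 → 𝕏 → ℝ} (hσ : ∀ a x, 0 < σ a x) (hσm : ∀ a, Measurable (σ a)) {η η' : 𝕏 → ℝ}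
    (hη : Measurable η) (hη' : Measurable η') (T t : ℕ) {p q : (Fin t → Obs 𝕏 2) → ℝ}
    (hp : Measurable p) (hq : Measurable q) (hp0 : ∀ h, 0 ≤ p h) (hq0 : ∀ h, 0 ≤ q h)
    (hpq : ∀ h, p h + q h = 1) :
    4 * ENNReal.ofReal (∑ x ∈ A, (A.card : ℝ)⁻¹ * Real.exp (-(η x - η' x) ^ 2 / 8)) ^ t ≤
      3 * (∫⁻ h, ENNReal.ofReal (p h) ∂(S.law (shiftProb hA σ η) T t) +
        ∫⁻ h, ENNReal.ofReal (q h) ∂(S.law (shiftProb hA σ η') T t)) + 2 := by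
  have hl := measurable_likelihood hσm hη
  have hl' := measurable_likelihood hσm hη'
  have hb := measurable_affinity hσm hη hη'
  have hL : Measurable fun h : Fin t → Obs 𝕏 2 => ∏ i, ENNReal.ofReal (likelihood σ η (h i)) := by
    fun_prop
  have change := S.lintegral_law_changeOfMeasure _ _ T hl.ennreal_ofReal
    (fun t g F hF => S.lintegral_step_changeOfMeasure hA hσ hσm hη T t g F hF) t
  have change' := S.lintegral_law_changeOfMeasure _ _ T hl'.ennreal_ofReal
    (fun t g F hF => S.lintegral_step_changeOfMeasure hA hσ hσm hη' T t g F hF) t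
  have one := change (fun _ => 1) measurable_const
  have one' := change' (fun _ => 1) measurable_const
  simp only [lintegral_one, measure_univ, one_mul] at one one'
  -- Writing `2` as the total mass of the two alternatives puts every term under one integral, so
  -- the inequality can be checked pointwise.
  have two : (2 : ENNReal) = ∫⁻ h, ∏ i, ENNReal.ofReal (likelihood σ η (h i))
      ∂(S.law (shiftProb hA σ 0) T t) + ∫⁻ h, ∏ i, ENNReal.ofReal (likelihood σ η' (h i))
      ∂(S.law (shiftProb hA σ 0) T t) := by
    rw [← one, ← one', one_add_one_eq_two]
  rw [← S.lintegral_law_prod (shiftProb hA σ 0) T hb.ennreal_ofReal _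
      (fun t g => S.lintegral_step_affinity hA hσ hσm hη hη' T t g) t,
    change _ hp.ennreal_ofReal, change' _ hq.ennreal_ofReal, two,
    ← lintegral_add_left (by fun_prop), ← lintegral_add_left hL,
    ← lintegral_const_mul _ (by fun_prop), ← lintegral_const_mul _ (by fun_prop),
    ← lintegral_add_left (by fun_prop)]
  refine lintegral_mono fun h => ?_
  have n1 : 0 ≤ ∏ i, likelihood σ η (h i) := Finset.prod_nonneg fun i _ => (likelihood_pos _ _ _).le
  have n2 : 0 ≤ ∏ i, likelihood σ η' (h i) :=
    Finset.prod_nonneg fun i _ => (likelihood_pos _ _ _).le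
  have n3 := hp0 h
  have n4 := hq0 h
  dsimp only
  rw [← ENNReal.ofReal_prod_of_nonneg fun i _ => (affinity_pos _ _ _ _).le,
    ← ENNReal.ofReal_prod_of_nonneg fun i _ => (likelihood_pos _ _ _).le,
    ← ENNReal.ofReal_prod_of_nonneg fun i _ => (likelihood_pos _ _ _).le,
    ← ENNReal.ofReal_mul n3, ← ENNReal.ofReal_mul n4, ← ENNReal.ofReal_add n1 n2,
    ← ENNReal.ofReal_add (by positivity) (by positivity),
    show (4 : ENNReal) = ENNReal.ofReal 4 by simp, show (3 : ENNReal) = ENNReal.ofReal 3 by simp,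
    ← ENNReal.ofReal_mul (by norm_num), ← ENNReal.ofReal_mul (by norm_num),
    ← ENNReal.ofReal_add (by positivity) (by positivity)]
  refine ENNReal.ofReal_le_ofReal (four_mul_le_of_sq_eq n1 n2 ?_ n3 n4 (hpq h))
  rw [← Finset.prod_pow, ← Finset.prod_mul_distrib]
  exact Finset.prod_congr rfl fun i _ => affinity_sq _ _ _ _

variable [MeasurableSingletonClass 𝕏]

open Classical in
/-- The two error probabilities at a context, when the better arm is changed only there. -/
lemma Strategy.half_le_error_add_error (S : Strategy 𝕏 2 C) {A : Finset 𝕏} (hA : A.Nonempty)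
    {σ : Fin 2 → 𝕏 → ℝ} (hσ : ∀ a x, 0 < σ a x) (hσm : ∀ a, Measurable (σ a)) {T : ℕ}
    (hT : 0 < T) {θ : ℝ} (hθ : θ ^ 2 = A.card / (4 * T)) {B : Finset 𝕏} {x : 𝕏} (hx : x ∈ A)
    (hxB : x ∉ B) :
    2⁻¹ ≤ ∫⁻ h, ENNReal.ofReal ((S.recommend T h).prob (worseArm B x) x)
        ∂(S.law (shiftProb hA σ (signShift θ B)) T T) +
      ∫⁻ h, ENNReal.ofReal ((S.recommend T h).prob (worseArm (insert x B) x) x)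
        ∂(S.law (shiftProb hA σ (signShift θ (insert x B))) T T) := by
  have hw : worseArm B x = 0 := by simp [worseArm, hxB]
  have hw' : worseArm (insert x B) x = 1 := by simp [worseArm]
  rw [hw, hw']
  have key := S.four_mul_affinity_pow_le hA hσ hσm (measurable_signShift θ B)
    (measurable_signShift θ (insert x B)) T T (S.measurable_recommend T 0 x)
    (S.measurable_recommend T 1 x) (fun h => (S.recommend T h).prob_nonneg 0 x)
    (fun h => (S.recommend T h).prob_nonneg 1 x)
    (fun h => by rw [← Fin.sum_univ_two fun a => (S.recommend T h).prob a x,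
      (S.recommend T h).sum_prob x])
  have hc : (0 : ℝ) < A.card := by exact_mod_cast hA.card_pos
  have hT' : (1 : ℝ) ≤ T := by exact_mod_cast hT
  -- The shifts differ only at `x`, by `2 * θ`; there `exp (-θ ^ 2 / 2) ≥ 1 - θ ^ 2 / 2`, with
  -- weight `1 / A.card`.
  have hρ : 1 - 1 / (8 * T) ≤ ∑ y ∈ A, (A.card : ℝ)⁻¹ *
      Real.exp (-(signShift θ B y - signShift θ (insert x B) y) ^ 2 / 8) := by
    calc (1 : ℝ) - 1 / (8 * T)
        = ∑ y ∈ A, (A.card : ℝ)⁻¹ * (1 - if y = x then θ ^ 2 / 2 else 0) := by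
          rw [← Finset.mul_sum, Finset.sum_sub_distrib, Finset.sum_ite_eq', if_pos hx, hθ]
          simp
          field_simp
          ring
      _ ≤ _ := by
          gcongr with y _
          refine le_trans (le_of_eq ?_) (Real.add_one_le_exp _)
          by_cases hyx : y = x
          · subst hyx
            simp [signShift, hxB]
            ring
          · simp [signShift, hyx]
  have hpow : (7 / 8 : ℝ) ≤ (∑ y ∈ A, (A.card : ℝ)⁻¹ *
      Real.exp (-(signShift θ B y - signShift θ (insert x B) y) ^ 2 / 8)) ^ T := by
    have h1 : 1 / (8 * (T : ℝ)) ≤ 1 := by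
      rw [div_le_one (by positivity)]; linarith
    calc (7 / 8 : ℝ) = 1 + T * (-(1 / (8 * T))) := by field_simp; norm_num
      _ ≤ (1 + -(1 / (8 * T))) ^ T := one_add_mul_le_pow (by linarith) T
      _ ≤ _ := by
        refine pow_le_pow_left₀ (by linarith) ?_ T
        linarith
  rw [← ENNReal.ofReal_pow (by positivity)] at key
  -- This reads `4 * (7/8) ≤ 3 * E + 2` for the sum `E` of the errors, hence `E ≥ 1/2`.
  have key2 := (mul_le_mul_right (ENNReal.ofReal_le_ofReal hpow) 4).trans key
  set E := ∫⁻ h, ENNReal.ofReal ((S.recommend T h).prob 0 x)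
        ∂(S.law (shiftProb hA σ (signShift θ B)) T T) +
      ∫⁻ h, ENNReal.ofReal ((S.recommend T h).prob 1 x)
        ∂(S.law (shiftProb hA σ (signShift θ (insert x B))) T T)
  clear_value E
  obtain hE | hE := eq_or_ne E ⊤
  · rw [hE]; exact le_top
  · lift E to NNReal using hE
    rw [show (4 : ENNReal) = ENNReal.ofReal 4 by simp, ← ENNReal.ofReal_mul (by norm_num),
      ENNReal.ofReal_le_iff_le_toReal (by finiteness)] at key2
    rw [ENNReal.toReal_add (by finiteness) (by finiteness), ENNReal.toReal_mul] at key2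
    norm_num at key2
    have : (2⁻¹ : NNReal) ≤ E := by
      rw [← NNReal.coe_le_coe]
      push_cast
      linarith
    calc (2⁻¹ : ENNReal) = ((2⁻¹ : NNReal) : ENNReal) := by
          rw [ENNReal.coe_inv (by norm_num)]; rfl
      _ ≤ E := by exact_mod_cast this

end Testing

/-- A finite supremum of natural numbers is attained if positive. For `M = 0` the class may be
empty, and then not even `∅` is shattered. -/
lemma exists_shatters_card_eq {𝕏 : Type*} [MeasurableSpace 𝕏] {C : Set (Policy 𝕏 2)} {M : ℕ}
    (hM : 0 < M) (hC : vcDim C = (M : ℕ∞)) :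
    ∃ A : Finset 𝕏, Shatters C A ∧ A.card = M := by
  by_contra! hne
  have hle : vcDim C ≤ ((M - 1 : ℕ) : ℕ∞) := by
    refine iSup₂_le fun A hA => ?_
    have h1 : (A.card : ℕ∞) ≤ M := hC ▸ le_iSup₂ (f := fun (S : Finset 𝕏) (_ : Shatters C S) =>
      (S.card : ℕ∞)) A hA
    have h2 : A.card ≤ M := by exact_mod_cast h1
    have h3 := hne A hA
    exact_mod_cast (show A.card ≤ M - 1 by omega)
  rw [hC] at hle
  have : M ≤ M - 1 := by exact_mod_cast hle
  omega

/-! ### Averaging over the subsets of the shattered set -/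

section LowerBound

variable {𝕏 : Type*} [MeasurableSpace 𝕏] [MeasurableSingletonClass 𝕏] {C : Set (Policy 𝕏 2)}

/-- Regret bound under a single alternative. -/
lemma Strategy.le_expectedRegret (S : Strategy 𝕏 2 C) {A : Finset 𝕏} (hA : A.Nonempty)
    {σ : Fin 2 → 𝕏 → ℝ} (hσ : ∀ a x, 0 < σ a x) {θ : ℝ} (hθ : 0 ≤ θ) (B : Finset 𝕏)
    (hC : Shatters C A) (T : ℕ) :
    ∑ x ∈ A, ENNReal.ofReal ((A.card : ℝ)⁻¹ * (θ * (σ 0 x + σ 1 x))) *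
        ∫⁻ h, ENNReal.ofReal ((S.recommend T h).prob (worseArm B x) x)
          ∂(S.law (shiftProb hA σ (signShift θ B)) T T) ≤
      S.expectedRegret (shiftProb hA σ (signShift θ B)) T := by
  have hm (a : Fin 2) (x : 𝕏) : Measurable fun h => ENNReal.ofReal ((S.recommend T h).prob a x) :=
    (S.measurable_recommend T a x).ennreal_ofReal
  have hw (x : 𝕏) : 0 ≤ (A.card : ℝ)⁻¹ * (θ * (σ 0 x + σ 1 x)) := by
    have := hσ 0 x
    have := hσ 1 x
    positivity
  simp_rw [← lintegral_const_mul _ (hm _ _)]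
  rw [← lintegral_finsetSum _ fun x _ => (hm _ _).const_mul _]
  refine lintegral_mono fun h => ?_
  refine le_trans (le_of_eq ?_)
    (ENNReal.ofReal_le_ofReal (le_regret_signShift hA σ θ B hC (S.recommend T h)))
  rw [ENNReal.ofReal_sum_of_nonneg fun x _ => mul_nonneg (hw x) (Policy.prob_nonneg _ _ _)]
  exact Finset.sum_congr rfl fun x _ => (ENNReal.ofReal_mul (hw x)).symm

/-- Averaging a function of subsets of `A` whose sums over pairs `B, insert x B` are bounded
below. -/
lemma le_sum_powerset {α : Type*} [DecidableEq α] {A : Finset α} {x : α} (hx : x ∈ A)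
    (f : Finset α → ENNReal) (hf : ∀ B, x ∉ B → 2⁻¹ ≤ f B + f (insert x B)) :
    2 ^ A.card * 4⁻¹ ≤ ∑ B ∈ A.powerset, f B := by
  -- The subsets of `A` split into `2 ^ D.card` pairs `B`, `insert x B`, each contributing at least
  -- `1/2`.
  obtain ⟨D, hxD, rfl⟩ : ∃ D, x ∉ D ∧ insert x D = A :=
    ⟨A.erase x, by simp, Finset.insert_erase hx⟩
  rw [Finset.sum_powerset_insert hxD, ← Finset.sum_add_distrib, Finset.card_insert_of_notMem hxD]
  calc (2 : ENNReal) ^ (D.card + 1) * 4⁻¹ = ∑ B ∈ D.powerset, 2⁻¹ := by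
        rw [Finset.sum_const, Finset.card_powerset, nsmul_eq_mul, pow_succ, mul_assoc]
        push_cast
        congr 1
        rw [show (4 : ENNReal) = 2 * 2 by norm_num, ENNReal.mul_inv (by simp) (by simp),
          ← mul_assoc, ENNReal.mul_inv_cancel (by simp) (by simp), one_mul]
    _ ≤ _ := Finset.sum_le_sum fun B hB => hf B fun h => hxD (Finset.mem_powerset.1 hB h)

/-- The minimax lower bound, for every budget. -/
lemma Strategy.le_iSup_expectedRegret (S : Strategy 𝕏 2 C) {A : Finset 𝕏} (hA : A.Nonempty)
    (hC : Shatters C A) {σ : Fin 2 → 𝕏 → ℝ} (hσ : ∀ a x, 0 < σ a x) {ζ : ProbabilityMeasure 𝕏}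
    (hζ : (ζ : Measure 𝕏) = uniformContext A) {T : ℕ} (hT : 0 < T) :
    ENNReal.ofReal (1 / 8 * ∫ x, √((A.card : ℝ) * (σ 0 x + σ 1 x) ^ 2) ∂(ζ : Measure 𝕏)) ≤
      ⨆ P ∈ banditModel σ ζ, ENNReal.ofReal √(T : ℝ) * S.expectedRegret P T := by
  classical
  -- `σ` need not be measurable, but a function equal to `1` off a finite set is.
  set τ : Fin 2 → 𝕏 → ℝ := fun a x => if x ∈ A then σ a x else 1 with hτdef
  have hτ (a : Fin 2) (x : 𝕏) : 0 < τ a x := by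
    simp only [hτdef]; split_ifs
    exacts [hσ a x, one_pos]
  have hτA (a : Fin 2) (x : 𝕏) (hx : x ∈ A) : τ a x = σ a x := by simp [hτdef, hx]
  have hτm (a : Fin 2) : Measurable (τ a) := by
    refine (measurable_const (a := (1 : ℝ))).measurable_of_countable_ne
      (A.countable_toSet.mono fun x hx => ?_)
    by_contra h
    exact hx (by simp [hτdef, Finset.mem_coe.not.1 h])
  have hc : (0 : ℝ) < A.card := by exact_mod_cast hA.card_pos
  have hT' : (0 : ℝ) < T := by exact_mod_cast hT
  set θ : ℝ := √(A.card / (4 * T)) with hθdef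
  have hθ : 0 ≤ θ := Real.sqrt_nonneg _
  have hθ2 : θ ^ 2 = A.card / (4 * T) := Real.sq_sqrt (by positivity)
  have hTθ : √(T : ℝ) * θ = √(A.card : ℝ) / 2 := by
    rw [hθdef, ← Real.sqrt_mul hT'.le, show (T : ℝ) * (A.card / (4 * T)) = A.card / 2 ^ 2 by
      field_simp; norm_num, Real.sqrt_div hc.le, Real.sqrt_sq (by norm_num)]
  set V := ⨆ P ∈ banditModel σ ζ, ENNReal.ofReal √(T : ℝ) * S.expectedRegret P T
  have hV (B : Finset 𝕏) :
      ENNReal.ofReal √(T : ℝ) * S.expectedRegret (shiftProb hA τ (signShift θ B)) T ≤ V :=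
    le_iSup₂ (f := fun P (_ : P ∈ banditModel σ ζ) => ENNReal.ofReal √(T : ℝ) *
      S.expectedRegret P T) _ (shiftProb_mem_banditModel hA hτA _ hζ)
  have hw (x : 𝕏) : 0 ≤ (A.card : ℝ)⁻¹ * (θ * (τ 0 x + τ 1 x)) := by
    have := hτ 0 x
    have := hτ 1 x
    positivity
  -- The average over `B` is kept as a sum over all subsets, which avoids dividing in `ENNReal`.
  have hsum : (2 : ENNReal) ^ A.card * ENNReal.ofReal
      (1 / 8 * ∫ x, √((A.card : ℝ) * (σ 0 x + σ 1 x) ^ 2) ∂(ζ : Measure 𝕏)) ≤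
      2 ^ A.card * V := by
    calc _ = ENNReal.ofReal √(T : ℝ) * ∑ x ∈ A,
          ENNReal.ofReal ((A.card : ℝ)⁻¹ * (θ * (τ 0 x + τ 1 x))) * (2 ^ A.card * 4⁻¹) := by
          rw [← Finset.sum_mul, ← ENNReal.ofReal_sum_of_nonneg fun x _ => hw x,
            mul_comm ((2 : ENNReal) ^ _) 4⁻¹, ← mul_assoc, ← mul_assoc,
            ← ENNReal.ofReal_mul (Real.sqrt_nonneg _), mul_comm, show (4⁻¹ : ENNReal) =
              ENNReal.ofReal 4⁻¹ by rw [ENNReal.ofReal_inv_of_pos (by norm_num)]; simp,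
            ← ENNReal.ofReal_mul (mul_nonneg (Real.sqrt_nonneg _)
              (Finset.sum_nonneg fun x _ => hw x)), hζ, integral_uniformContext, Finset.mul_sum,
            Finset.mul_sum, Finset.sum_mul]
          congr 2
          refine Finset.sum_congr rfl fun x hx => ?_
          have h0 := hσ 0 x
          have h1 := hσ 1 x
          rw [hτA 0 x hx, hτA 1 x hx, Real.sqrt_mul hc.le, Real.sqrt_sq (by positivity)]
          calc _ = (√(A.card : ℝ) / 2) * ((A.card : ℝ)⁻¹ * (σ 0 x + σ 1 x)) * 4⁻¹ := by ring
            _ = _ := by rw [← hTθ]; ring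
      _ ≤ ENNReal.ofReal √(T : ℝ) * ∑ x ∈ A,
          ENNReal.ofReal ((A.card : ℝ)⁻¹ * (θ * (τ 0 x + τ 1 x))) * ∑ B ∈ A.powerset,
            ∫⁻ h, ENNReal.ofReal ((S.recommend T h).prob (worseArm B x) x)
              ∂(S.law (shiftProb hA τ (signShift θ B)) T T) := by
          gcongr with x hx
          exact le_sum_powerset hx _ fun B hB => by
            convert! S.half_le_error_add_error hA hτ hτm hT hθ2 hx hB
      _ = ∑ B ∈ A.powerset, ENNReal.ofReal √(T : ℝ) * ∑ x ∈ A,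
          ENNReal.ofReal ((A.card : ℝ)⁻¹ * (θ * (τ 0 x + τ 1 x))) *
            ∫⁻ h, ENNReal.ofReal ((S.recommend T h).prob (worseArm B x) x)
              ∂(S.law (shiftProb hA τ (signShift θ B)) T T) := by
          rw [← Finset.mul_sum, Finset.sum_comm]
          simp_rw [Finset.mul_sum]
      _ ≤ ∑ B ∈ A.powerset, V := by
          refine Finset.sum_le_sum fun B _ => le_trans ?_ (hV B)
          gcongr
          exact S.le_expectedRegret hA hτ hθ B hC T
      _ = 2 ^ A.card * V := by simp
  exact (ENNReal.mul_le_mul_iff_right (by simp) (by simp)).1 hsum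

end LowerBound

end

end ContextualBAI

open ContextualBAI
theorem theorem2 {d : ℕ} (𝒳 : Set (EuclideanSpace ℝ (Fin d))) (h𝒳 : 𝒳.Nonempty)
    (M : ℕ) (C : Set (Policy 𝒳 2)) (hC : vcDim C = (M : ℕ∞)) :
    ∃ ζ : ProbabilityMeasure 𝒳,
      ∀ σ : Fin 2 → 𝒳 → ℝ, (∀ a x, 0 < σ a x) →
        Integrable (fun x => √((M : ℝ) * (σ 0 x + σ 1 x) ^ 2)) (ζ : Measure 𝒳) ∧
        ∀ S : Strategy 𝒳 2 C, S.NullConsistent σ ζ →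
          ∃ r : ℕ → ℝ, Tendsto r atTop (𝓝 0) ∧
            ∀ T : ℕ,
              ENNReal.ofReal
                  (1 / 8 * ∫ x, √((M : ℝ) * (σ 0 x + σ 1 x) ^ 2) ∂(ζ : Measure 𝒳) + r T) ≤
                ⨆ P ∈ banditModel σ ζ, ENNReal.ofReal √(T : ℝ) * S.expectedRegret P T := by
  obtain rfl | hM := Nat.eq_zero_or_pos M
  -- For `M = 0` the bound is zero, so any point mass serves.
  · exact ⟨⟨Measure.dirac ⟨_, h𝒳.some_mem⟩, inferInstance⟩, fun σ _ =>
      ⟨by simp, fun S _ => ⟨fun _ => 0, tendsto_const_nhds, fun T => by simp⟩⟩⟩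
  obtain ⟨A, hAC, rfl⟩ := exists_shatters_card_eq hM hC
  have hA : A.Nonempty := Finset.card_pos.1 hM
  refine ⟨⟨uniformContext A, isProbabilityMeasure_uniformContext hA⟩, fun σ hσ =>
    ⟨integrable_uniformContext A _, fun S _ => ?_⟩⟩
  set I := 1 / 8 * ∫ x, √((A.card : ℝ) * (σ 0 x + σ 1 x) ^ 2) ∂(uniformContext A) with hI
  -- The error term is needed only at `T = 0`, where the factor `√T` makes the right-hand side zero.
  refine ⟨fun T => if T = 0 then -I else 0, ?_, fun T => ?_⟩
  · refine tendsto_const_nhds.congr' ?_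
    filter_upwards [eventually_ne_atTop 0] with T hT
    simp [hT]
  · change ENNReal.ofReal (I + if T = 0 then -I else 0) ≤ _
    obtain rfl | hT := Nat.eq_zero_or_pos T
    · rw [if_pos rfl, add_neg_cancel, ENNReal.ofReal_zero]
      exact zero_le
    · rw [if_neg hT.ne', add_zero]
      exact S.le_iSup_expectedRegret hA hAC hσ rfl hT
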